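/- An instance of the Minimum Maximum Sensor Movement problem (MMSM) consists of a barrier $[0,M]$ on the $x$-axis, with $M\ge 1$ an integer, and sensors $1,\dots,n$; sensor $i$ has position $(x_i,y_i)\in\mathbb{R}^2$ and radius $r_i$ such that $2r_i$ is a non-negative integer. Let $r_{\max}=\max_i r_i$. A solution with maximum relocation distance at most $d$ is a choice of new positions $(x_i',0)$, $i=1,\dots,n$, such that $\sqrt{(x_i-x_i')^2+y_i^2}\le d$ for every $i$ and every point $p\in[0,M]$ satisfies $|p-x_i'|\le r_i$ for some $i$. The instance is feasible under $d$ if such a solution exists, and $D^*$ is the minimum $D\in\{0,1,2,\dots\}$ under which it is feasible ($D^*=\infty$ if there is none). Let $D\ge 0$ be an integer. For a sensor with $|y_i|\le D$ let $l_i=x_i-\sqrt{D^2-y_i^2}-r_i$ and $g_i=x_i+\sqrt{D^2-y_i^2}+r_i$ be the leftmost and the rightmost point of the axis that it can cover when it is relocated to the axis within distance $D$, and let $J_i=\{j\in\mathbb{Z}:\lceil l_i\rceil\le j\le\lfloor g_i\rfloor\}$; for a sensor with $|y_i|>D$ let $J_i=\emptyset$. Split the barrier into the unit edges $e_j=[j,j+1]$,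 $0\le j<M$, and let $H$ be the bipartite graph between these $M$ edges and $2r_i$ copies of each sensor $i$, in which $e_j$ is joined to every copy of sensor $i$ if $j\in J_i$ (and to no copy of it otherwise). The algorithm computes a maximum cardinality matching $\mathcal{Y}$ of $H$ and returns "feasible" if $|\mathcal{Y}|=M$, and "infeasible" otherwise. **Theorem.** Let $\mathcal{Y}$ be any maximum cardinality matching of $H$. 1. If $|\mathcal{Y}|\ne M$ (the algorithm returns "infeasible"), then $D<D^*$. 2. Suppose that $|\mathcal{Y}|=M$ (the algorithm returns "feasible") and that $r_{\max}$ is an integer. Then $\mathcal{Y}$ can be transferred to a solution with maximum relocation distance at most $D+r_{\max}$: there are new positions $(x_i',0)$ of the sensors and a permutation $\sigma$ of the edge indices $\{0,\dots,M-1\}$ such that, whenever $\mathcal{Y}$ matches $e_j$ to a copy of sensor $i$, sensor $i$ moves by at most $D+r_{\max}$ and at its new position covers the whole edge $e_{\sigma(j)}$. If moreover $|y_i|\le D+r_{\max}$ for all $i$ (that is, every sensor, including those not used by $\mathcal{Y}$, can reach the axis within distance $D+r_{\max}$), then these positions form a solution of the MMSM instance with maximum relocation distance at most $D+r_{\max}$.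 -/

import Mathlib

/-- An instance of the two-dimensional Minimum Maximum Sensor Movement problem (MMSM):
the barrier is the segment `[0, M]` of the `x`-axis, and sensor `i` sits at `(x i, y i)` and has
sensing diameter `w i`, that is, sensing radius `r i = w i / 2`. -/
structure MMSMInstance where
  /-- length of the barrier -/
  M : ℕ
  /-- number of sensors -/
  n : ℕ
  /-- abscissas of the sensors -/
  x : Fin n → ℝ
  /-- ordinates of the sensors -/
  y : Fin n → ℝ
  /-- sensing diameters `2 r_i` of the sensors -/
  w : Fin n → ℕ

namespace MMSMInstance

/-- The sensing radius of sensor `i`. -/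
noncomputable def r (I : MMSMInstance) (i : Fin I.n) : ℝ := (I.w i : ℝ) / 2

/-- The maximum sensing radius. -/
noncomputable def rmax (I : MMSMInstance) : ℝ := ((Finset.univ.sup I.w : ℕ) : ℝ) / 2

/-- The distance by which sensor `i` moves when it is relocated to `(c, 0)`. -/
noncomputable def moveDist (I : MMSMInstance) (i : Fin I.n) (c : ℝ) : ℝ :=
  Real.sqrt ((I.x i - c) ^ 2 + (I.y i - 0) ^ 2)

/-- `x'` is a solution with maximum relocation distance at most `d`: relocating every sensor `i` to
`(x' i, 0)` moves no sensor by more than `d`, and each point of the barrier is within distance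
`r i` of the new position of some sensor `i`. -/
def IsSolution (I : MMSMInstance) (d : ℝ) (x' : Fin I.n → ℝ) : Prop :=
  (∀ i, I.moveDist i (x' i) ≤ d) ∧
    ∀ p ∈ Set.Icc (0 : ℝ) I.M, ∃ i, |p - x' i| ≤ I.r i

/-- The instance is feasible under the relocation distance bound `d`. -/
def Feasible (I : MMSMInstance) (d : ℝ) : Prop := ∃ x', I.IsSolution d x'

/-- The minimum `D* ∈ {0, 1, 2, …}` under which the instance is feasible (`⊤` if there is none). -/
noncomputable def Dstar (I : MMSMInstance) : ℕ∞ :=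
  ⨅ D ∈ {D : ℕ | I.Feasible D}, (D : ℕ∞)

/-- For `|y i| ≤ D`, the leftmost point that sensor `i` can cover after being relocated to the axis
within distance `D`. -/
noncomputable def leftmost (I : MMSMInstance) (D : ℝ) (i : Fin I.n) : ℝ :=
  I.x i - Real.sqrt (D ^ 2 - I.y i ^ 2) - I.r i

/-- For `|y i| ≤ D`, the rightmost point that sensor `i` can cover after being relocated to the axis
within distance `D`. -/
noncomputable def rightmost (I : MMSMInstance) (D : ℝ) (i : Fin I.n) : ℝ :=
  I.x i + Real.sqrt (D ^ 2 - I.y i ^ 2) + I.r i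

/-- The set `J_i` of the indices `j ∈ [⌈l_i⌉, ⌊g_i⌋]`, where `l_i` and `g_i` are the leftmost and the
rightmost point that sensor `i` can cover; it is empty for a sensor that cannot reach the axis. -/
def J (I : MMSMInstance) (D : ℝ) (i : Fin I.n) : Set ℤ :=
  {j | |I.y i| ≤ D ∧ ⌈I.leftmost D i⌉ ≤ j ∧ j ≤ ⌊I.rightmost D i⌋}

/-- The vertices of the bipartite graph: the `M` unit edges `e_j = [j, j + 1]`, `0 ≤ j < M`, of the
barrier, and `2 r_i` copies of each sensor `i`. -/
abbrev Vertex (I : MMSMInstance) : Type := Fin I.M ⊕ (Σ i : Fin I.n, Fin (I.w i))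

/-- The bipartite graph `H`: the edge `e_j` is joined to all copies of sensor `i` if `j ∈ J_i`. -/
def H (I : MMSMInstance) (D : ℝ) : SimpleGraph I.Vertex :=
  SimpleGraph.fromRel fun u v =>
    ∃ (j : Fin I.M) (i : Fin I.n) (l : Fin (I.w i)),
      u = Sum.inl j ∧ v = Sum.inr ⟨i, l⟩ ∧ ((j : ℕ) : ℤ) ∈ I.J D i

/-- `Y` is a matching of `H` of maximum cardinality. -/
def IsMaximumMatching (I : MMSMInstance) (D : ℝ) (Y : (I.H D).Subgraph) : Prop :=
  Y.IsMatching ∧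
    ∀ Y' : (I.H D).Subgraph, Y'.IsMatching → Y'.edgeSet.ncard ≤ Y.edgeSet.ncard

/-- The outcome `feasible` of the algorithm when it has computed the maximum matching `Y`. -/
def ReturnsFeasible (I : MMSMInstance) (D : ℝ) (Y : (I.H D).Subgraph) : Prop :=
  Y.edgeSet.ncard = I.M

/-- The matching `Y` assigns the unit edge `e_j` to (some copy of) sensor `i`. -/
def Assigns (I : MMSMInstance) (D : ℝ) (Y : (I.H D).Subgraph) (j : Fin I.M) (i : Fin I.n) : Prop :=
  ∃ l : Fin (I.w i), Y.Adj (Sum.inl j) (Sum.inr ⟨i, l⟩)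

/-- Sensor `i`, relocated to `(c, 0)`, covers every point of the unit edge `e_j = [j, j + 1]`. -/
def CoversEdge (I : MMSMInstance) (i : Fin I.n) (c : ℝ) (j : Fin I.M) : Prop :=
  ∀ p ∈ Set.Icc ((j : ℕ) : ℝ) ((j : ℕ) + 1), |p - c| ≤ I.r i

end MMSMInstance

/-!
If the instance is feasible under `D`, the matching is read off a solution `x'`: writing
`a i = x' i - r i`, finitely many closed intervals `[a i, a i + w i]` cover `[0, M]`, so each integer
`j < M` satisfies `a i ≤ j < a i + w i` for some `i`. Matching `e_j` to the copy number `j - ⌈a i⌉` of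
sensor `i` then gives a matching with `M` edges (`MMSMInstance.Feasible.exists_matching`), hence a
maximum matching has `M` edges as well.

Conversely, let `Y` have `M` edges and let `R = r_max`. Then `Y` is a schedule of the unit time slots
`0, …, M - 1`, in which the group of units of sensor `i` has at most `w i ≤ 2 R` members, all in the
window `⌈l_i⌉ ≤ j ≤ ⌊g_i⌋`. A sensor whose distance bound grows from `D` to `D + R` reaches `R` further
on both sides, so the units have to be permuted such that the group of sensor `i` fits into an
interval of length `w i` within the range enlarged by `R` on both sides.
As an edge `e_j` ends at `j + 1`, a unit is allowed to move to the left by `R`, but to the right only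
by `R - 1`.

First the schedule is put into earliest-deadline-first order (`exists_edf_perm`): a permutation that
maximizes `∑ t * ρ (f t)`, where `ρ` ranks the groups by deadline, has between two units
of a group only units of this group and of groups of smaller `ρ`. The hulls of the groups are now nested or disjoint, and the
group `i` of largest `ρ` is interrupted only by groups that lie entirely between two consecutive
units of `i`.

Then the groups are made contiguous one by one, outermost first (`exists_consolidation`). Suppose
that the hull of `i` is currently shifted by `s ∈ [-R, R - 1]` and that `i` has `k ≤ 2 R` units. The
groups that come after `q` units of `i` can be shifted by `s - q` or by `s + k - q`, according to
whether the block of `i` is placed behind or before them. The first option respects `[-R, R - 1]` when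
`q ≤ s + R`, the second when `q ≥ s + k - R + 1`, and since `k ≤ 2 R` one threshold for `q` serves all
groups. Choosing the side anew at each level is what keeps the shifts from adding up along a chain
of nested groups.
-/

/-! ### Ranks in a finite set of integers -/

/-- The number of elements of the finite set `S` that lie strictly to the left of `x`. -/
def rankBelow (S : Finset ℤ) (x : ℤ) : ℤ := ((S.filter (· < x)).card : ℤ)

lemma rankBelow_nonneg (S : Finset ℤ) (x : ℤ) : 0 ≤ rankBelow S x := Int.natCast_nonneg _

lemma rankBelow_le_card (S : Finset ℤ) (x : ℤ) : rankBelow S x ≤ S.card :=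
  Int.ofNat_le.2 (Finset.card_filter_le _ _)

lemma rankBelow_mono (S : Finset ℤ) {x y : ℤ} (h : x ≤ y) : rankBelow S x ≤ rankBelow S y :=
  Int.ofNat_le.2 (Finset.card_le_card fun t ht => by
    rw [Finset.mem_filter] at ht ⊢
    exact ⟨ht.1, ht.2.trans_le h⟩)

lemma rankBelow_lt {S : Finset ℤ} {x y : ℤ} (hx : x ∈ S) (h : x < y) :
    rankBelow S x < rankBelow S y := by
  refine Int.ofNat_lt.2 (Finset.card_lt_card ((Finset.ssubset_iff_of_subset ?_).2 ⟨x, ?_, ?_⟩))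
  · intro t ht
    rw [Finset.mem_filter] at ht ⊢
    exact ⟨ht.1, ht.2.trans h⟩
  · exact Finset.mem_filter.2 ⟨hx, h⟩
  · simp

lemma rankBelow_lt_card {S : Finset ℤ} {x : ℤ} (hx : x ∈ S) : rankBelow S x < S.card :=
  Int.ofNat_lt.2 (Finset.card_lt_card (Finset.filter_ssubset.2 ⟨x, hx, lt_irrefl x⟩))

lemma rankBelow_injOn (S : Finset ℤ) : Set.InjOn (rankBelow S) S := by
  intro x hx y hy h
  rcases lt_trichotomy x y with hlt | rfl | hlt
  · exact absurd h (rankBelow_lt hx hlt).ne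
  · rfl
  · exact absurd h (rankBelow_lt hy hlt).ne'

/-- `rankBelow S` enumerates `S`: every `p < #S` is the rank of an element of `S`. -/
lemma exists_rankBelow_eq {S : Finset ℤ} {p : ℤ} (h0 : 0 ≤ p) (h1 : p < S.card) :
    ∃ x ∈ S, rankBelow S x = p := by
  have h := Finset.surjOn_of_injOn_of_card_le (s := S) (t := Finset.Ico (0 : ℤ) S.card)
    (rankBelow S)
    (fun x hx => by
      simpa using ⟨rankBelow_nonneg S x, rankBelow_lt_card hx⟩)
    (rankBelow_injOn S) (by simp)
  exact h (by simpa using ⟨h0, h1⟩)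

lemma rankBelow_congr {S : Finset ℤ} {x y : ℤ} (h : x ≤ y) (hS : ∀ t ∈ S, x ≤ t → ¬ t < y) :
    rankBelow S x = rankBelow S y := by
  unfold rankBelow
  congr 2
  refine Finset.filter_congr fun t ht => ⟨fun h' => h'.trans_le h, fun h' => ?_⟩
  by_contra hc
  exact hS t ht (not_lt.1 hc) h'

/-- A strictly increasing integer-valued map grows at least as fast as the number of points. -/
lemma rankBelow_le_add {S : Finset ℤ} {U : Set ℤ} {φ : ℤ → ℤ} (hφ : StrictMonoOn φ U)
    (hS : ∀ t ∈ S, t ∈ U) {x y : ℤ} (hx : x ∈ U) (hy : y ∈ U) (h : x ≤ y) :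
    rankBelow S y ≤ rankBelow S x + (φ y - φ x) := by
  have h1 : S.filter (· < y) ⊆ S.filter (· < x) ∪ S.filter (fun t => x ≤ t ∧ t < y) := by
    intro t ht
    simp only [Finset.mem_union, Finset.mem_filter] at ht ⊢
    rcases lt_or_ge t x with h' | h'
    · exact Or.inl ⟨ht.1, h'⟩
    · exact Or.inr ⟨ht.1, h', ht.2⟩
  have h2 : (S.filter (fun t => x ≤ t ∧ t < y)).card ≤ (Finset.Ico (φ x) (φ y)).card := by
    refine Finset.card_le_card_of_injOn φ (fun t ht => ?_)
      (hφ.injOn.mono fun t ht => hS t (Finset.mem_filter.1 ht).1)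
    obtain ⟨ht, h3, h4⟩ := Finset.mem_filter.1 ht
    exact Finset.mem_coe.2 (Finset.mem_Ico.2
      ⟨hφ.monotoneOn hx (hS t ht) h3, hφ (hS t ht) hy h4⟩)
  have h3 := (Finset.card_le_card h1).trans (Finset.card_union_le _ _)
  have h4 := hφ.monotoneOn hx hy h
  rw [Int.card_Ico] at h2
  unfold rankBelow
  omega

/-- The inequality of `rankBelow_le_add` is strict if the left end `x` is not counted by `S`. -/
lemma rankBelow_lt_add {S : Finset ℤ} {U : Set ℤ} {φ : ℤ → ℤ} (hφ : StrictMonoOn φ U)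
    (hS : ∀ t ∈ S, t ∈ U) {x y : ℤ} (hx : x ∈ U) (hy : y ∈ U) (hxS : x ∉ S) (h : x < y) :
    rankBelow S y < rankBelow S x + (φ y - φ x) := by
  have h1 := rankBelow_le_add (S := insert x S) hφ
    (fun t ht => (Finset.mem_insert.1 ht).elim (fun h => h ▸ hx) (hS t)) hx hy h.le
  have h2 : rankBelow (insert x S) y = rankBelow S y + 1 := by
    unfold rankBelow
    rw [Finset.filter_insert, if_pos h, Finset.card_insert_of_notMem]
    · push_cast; rfl
    · exact fun hc => hxS (Finset.mem_filter.1 hc).1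
  have h3 : rankBelow (insert x S) x = rankBelow S x := by
    unfold rankBelow
    rw [Finset.filter_insert, if_neg (lt_irrefl x)]
  omega

/-! ### Making nested groups contiguous -/

/-- The slots `U` carry units of groups `f t`, and unit `t` has been shifted to `φ t`, by an
amount in `[-R, R - 1]`. Between two units of a group lie only units of rank `ρ` at most that of
the group, and all of this hull has been shifted by the same amount. Then the units can be
rearranged within the places `φ U`, so that two units of group `i` differ by less than `w i` and
every unit lies in the window `[L, G]` of its group, enlarged by `R` on the left and by `R - 1` on
the right.

The induction removes the group of largest rank. Carrying an arbitrary strictly increasing `φ` on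
an arbitrary `U`, instead of treating each gap separately, lets a single call of the induction
hypothesis deal with all gaps. -/
theorem exists_consolidation {ι : Type*} [DecidableEq ι] {ρ : ι → ℤ} (hρ : Function.Injective ρ)
    {w : ι → ℕ} {R : ℤ} (hw : ∀ i, (w i : ℤ) ≤ 2 * R) {L G : ι → ℤ} {f : ℤ → ι}
    (U : Finset ℤ) :
    ∀ φ : ℤ → ℤ, StrictMonoOn φ U → (∀ t ∈ U, -R ≤ φ t - t ∧ φ t - t < R) →
      (∀ t ∈ U, L (f t) ≤ t ∧ t ≤ G (f t)) →
      (∀ i, (U.filter (f · = i)).card ≤ w i) →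
      (∀ t ∈ U, ∀ v ∈ U, f t = f v → ∀ u, t ≤ u → u ≤ v →
        u ∈ U ∧ ρ (f u) ≤ ρ (f t) ∧ φ u - u = φ t - t) →
      ∃ g : ℤ → ℤ, Set.InjOn g U ∧ (∀ t ∈ U, ∃ s ∈ U, g t = φ s) ∧
        (∀ t ∈ U, L (f t) - R ≤ g t ∧ g t < G (f t) + R) ∧
        ∀ t ∈ U, ∀ v ∈ U, f t = f v → g t - g v < w (f t) := by
  induction U using Finset.strongInduction with
  | H U ih =>
  intro φ hφ hR hLG hcard hnest
  rcases U.eq_empty_or_nonempty with rfl | hne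
  · exact ⟨id, by simp, by simp, by simp, by simp⟩
  obtain ⟨t₀, ht₀, hmax⟩ := U.exists_max_image (fun t => ρ (f t)) hne
  set i := f t₀ with hi
  set S := U.filter (f · = i) with hS
  have memS : ∀ t, t ∈ S ↔ t ∈ U ∧ f t = i := fun t => Finset.mem_filter
  have hSU : ∀ t ∈ S, t ∈ (U : Set ℤ) := fun t ht => ((memS t).1 ht).1
  have ht₀S : t₀ ∈ S := (memS t₀).2 ⟨ht₀, rfl⟩
  set P := rankBelow S with hP
  obtain ⟨k, hk⟩ : ∃ k : ℤ, k = S.card := ⟨_, rfl⟩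
  have hk0 : 0 < k := by rw [hk]; exact_mod_cast Finset.card_pos.2 ⟨t₀, ht₀S⟩
  have hkw : k ≤ w i := by rw [hk]; exact_mod_cast hcard i
  have hkR : k ≤ 2 * R := hkw.trans (hw i)
  obtain ⟨s, hs⟩ : ∃ s, s = φ t₀ - t₀ := ⟨_, rfl⟩
  have hsR := hR t₀ ht₀
  obtain ⟨p, hp⟩ : ∃ p, p = min (s + R) (k - 1) := ⟨_, rfl⟩
  -- `a` and `z` are the first and the last unit of `i`. Exactly `p` units of `i` precede `u`; the
  -- block of `i` is placed around `u`. The bound `k - 1` on `p` ensures that there is such a `u`.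
  obtain ⟨a, ha, haP⟩ := exists_rankBelow_eq (S := S) (p := 0) le_rfl (by omega)
  obtain ⟨z, hz, hzP⟩ := exists_rankBelow_eq (S := S) (p := k - 1) (by omega) (by omega)
  obtain ⟨u, hu, huP⟩ := exists_rankBelow_eq (S := S) (p := p) (by omega) (by omega)
  rw [← hP] at haP hzP huP
  have P0 : ∀ t, 0 ≤ P t := rankBelow_nonneg S
  have Pk : ∀ t, P t ≤ k := fun t => hk ▸ rankBelow_le_card S t
  have Pmono : ∀ x y, x ≤ y → P x ≤ P y := fun x y h => rankBelow_mono S h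
  have Plt : ∀ x ∈ S, ∀ y, x < y → P x < P y := fun x hx y h => rankBelow_lt hx h
  have Plip : ∀ x y, x ≤ y → P y ≤ P x + (y - x) := fun x y h =>
    rankBelow_le_add (φ := id) (U := Set.univ) (strictMono_id.strictMonoOn _)
      (fun _ _ => trivial) trivial trivial h
  have Plip' : ∀ x ∉ S, ∀ y, x < y → P y < P x + (y - x) := fun x hx y h =>
    rankBelow_lt_add (φ := id) (U := Set.univ) (strictMono_id.strictMonoOn _)
      (fun _ _ => trivial) trivial trivial hx h
  have Pφ : ∀ x ∈ U, ∀ y ∈ U, x ≤ y → P y ≤ P x + (φ y - φ x) := fun x hx y hy h =>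
    rankBelow_le_add hφ hSU hx hy h
  have Pφ' : ∀ x ∈ U, x ∉ S → ∀ y ∈ U, x < y → P y < P x + (φ y - φ x) :=
    fun x hx hxS y hy h => rankBelow_lt_add hφ hSU hx hy hxS h
  have le_of_P : ∀ x ∈ S, ∀ y, P y ≤ P x → y ≤ x := fun x hx y h => by
    by_contra hc
    exact absurd (Plt x hx y (not_le.1 hc)) (not_lt.2 h)
  have lt_of_P : ∀ x y, P x < P y → x < y := fun x y h => by
    by_contra hc
    exact absurd (Pmono y x (not_lt.1 hc)) (not_le.2 h)
  have hull₀ : ∀ t, a ≤ t → t ≤ z → t ∈ U ∧ φ t - t = φ a - a := fun t h1 h2 => by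
    have := hnest a (hSU a ha) z (hSU z hz)
      (((memS a).1 ha).2.trans ((memS z).1 hz).2.symm) t h1 h2
    exact ⟨this.1, this.2.2⟩
  have inHull : ∀ t ∈ S, a ≤ t ∧ t ≤ z := fun t ht =>
    ⟨le_of_P t ht a (haP ▸ P0 t), le_of_P z hz t
      (by rw [hzP]; have := rankBelow_lt_card ht; rw [← hP, ← hk] at this; omega)⟩
  have hull : ∀ t, a ≤ t → t ≤ z → t ∈ U ∧ φ t = t + s := fun t h1 h2 => by
    have h3 := hull₀ t h1 h2
    have h4 := hull₀ t₀ (inHull t₀ ht₀S).1 (inHull t₀ ht₀S).2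
    exact ⟨h3.1, by omega⟩
  have hau := inHull u hu
  have hφu := (hull u hau.1 hau.2).2
  have hua := Plip a u hau.1
  have huz := Plip u z hau.2
  -- Units of the other groups: those to the left of `u` move left past the units of `i` before
  -- them, those to the right of `u` move right past the units of `i` after them.
  set φ' : ℤ → ℤ := fun t => if P t ≤ p then φ t - P t else φ t + k - P t with hφ'
  set U' := U.filter (f · ≠ i) with hU'
  have memU' : ∀ t, t ∈ U' ↔ t ∈ U ∧ f t ≠ i := fun t => Finset.mem_filter
  have nS : ∀ t ∈ U', t ∉ S := fun t ht hc => ((memU' t).1 ht).2 ((memS t).1 hc).2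
  have hU'U : ∀ t ∈ U', t ∈ U := fun t ht => ((memU' t).1 ht).1
  have hlt : ∀ t ∈ U', ρ (f t) < ρ i := fun t ht =>
    lt_of_le_of_ne (hmax t (hU'U t ht)) fun hc => ((memU' t).1 ht).2 (hρ hc)
  -- A unit of another group inside the hull of `i` stays inside the hull of `i` when it moves.
  have hmid : ∀ t ∈ U', 0 < P t → P t < k → a ≤ t - P t ∧ t + k - P t ≤ z ∧ φ t = t + s := by
    intro t ht h1 h2
    have h3 := lt_of_P a t (by omega)
    have h4 := le_of_P z hz t (by omega)
    have h5 : t < z := lt_of_le_of_ne h4 fun hc => nS t ht (hc ▸ hz)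
    have h6 := Plip a t h3.le
    have h7 := Plip' t (nS t ht) z h5
    exact ⟨by omega, by omega, (hull t h3.le h4).2⟩
  have himg' : ∀ t ∈ U', ∃ x ∈ U, φ' t = φ x := by
    intro t ht
    have h0 := P0 t
    have h1 := Pk t
    by_cases hend : P t = 0 ∨ P t = k
    · refine ⟨t, hU'U t ht, ?_⟩
      simp only [hφ']
      split_ifs <;> omega
    · obtain ⟨h2, h3, h4⟩ := hmid t ht (by omega) (by omega)
      by_cases hc : P t ≤ p
      · have h5 := hull (t - P t) h2 (by omega)
        exact ⟨_, h5.1, by simp only [hφ', if_pos hc]; omega⟩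
      · have h5 := hull (t + k - P t) (by omega) h3
        exact ⟨_, h5.1, by simp only [hφ', if_neg hc]; omega⟩
  obtain ⟨g, hginj, hgimg, hgLG, hgw⟩ := ih U'
    (Finset.filter_ssubset.2 ⟨t₀, ht₀, by simp [hi]⟩) φ'
    (by
      intro t ht v hv htv
      have h1 := Pφ' t (hU'U t ht) (nS t ht) v (hU'U v hv) htv
      have h2 := Pmono t v htv.le
      simp only [hφ']
      split_ifs <;> omega)
    (by
      intro t ht
      have h0 := P0 t
      have h1 := Pk t
      have h2 := hR t (hU'U t ht)
      by_cases hend : P t = 0 ∨ P t = k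
      · simp only [hφ']
        split_ifs <;> omega
      · obtain ⟨-, -, h4⟩ := hmid t ht (by omega) (by omega)
        simp only [hφ']
        split_ifs <;> omega)
    (fun t ht => hLG t (hU'U t ht))
    (fun j => (Finset.card_le_card
      (Finset.filter_subset_filter _ (Finset.filter_subset _ _))).trans (hcard j))
    (by
      intro t ht v hv htv x h1 h2
      have key : ∀ y, t ≤ y → y ≤ v → y ∈ U ∧ ρ (f y) ≤ ρ (f t) ∧ φ y - y = φ t - t :=
        hnest t (hU'U t ht) v (hU'U v hv) htv
      have hy : ∀ y, t ≤ y → y ≤ v → f y ≠ i := fun y h3 h4 hc => by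
        have h5 := (key y h3 h4).2.1
        rw [hc] at h5
        exact absurd (hlt t ht) (not_lt.2 h5)
      obtain ⟨h3, h4, h5⟩ := key x h1 h2
      have h6 : P t = P x := rankBelow_congr h1 fun y hyS h7 h8 =>
        hy y h7 (h8.le.trans h2) ((memS y).1 hyS).2
      refine ⟨(memU' x).2 ⟨h3, hy x h1 h2⟩, h4, ?_⟩
      simp only [hφ', h6]
      split_ifs <;> omega)
  -- The block of `i` fills exactly the room that the other units have left free.
  have havoid : ∀ t ∈ U', g t < φ u - p ∨ φ u - p + k ≤ g t := by
    intro t ht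
    obtain ⟨x, hx, hgx⟩ := hgimg t ht
    rw [hgx]
    by_cases hc : P x ≤ p
    · left
      have h1 := le_of_P u hu x (by omega)
      have h2 : x < u := lt_of_le_of_ne h1 fun hc' => nS x hx (hc' ▸ hu)
      have h3 := Pφ' x (hU'U x hx) (nS x hx) u (hSU u hu) h2
      simp only [hφ', if_pos hc]
      omega
    · right
      have h1 := lt_of_P u x (by omega)
      have h3 := Pφ u (hSU u hu) x (hU'U x hx) h1.le
      simp only [hφ', if_neg hc]
      omega
  have PkS : ∀ t ∈ S, P t < k := fun t ht => hk ▸ rankBelow_lt_card ht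
  have split : ∀ t ∈ U, (t ∈ S ∧ f t = i) ∨ (t ∈ U' ∧ f t ≠ i) := fun t ht => by
    by_cases h : f t = i
    · exact Or.inl ⟨(memS t).2 ⟨ht, h⟩, h⟩
    · exact Or.inr ⟨(memU' t).2 ⟨ht, h⟩, h⟩
  refine ⟨fun t => if f t = i then φ u - p + P t else g t, ?_, ?_, ?_, ?_⟩
  · intro t ht v hv h
    rcases split t ht with ⟨htS, hti⟩ | ⟨htU, hti⟩ <;>
      rcases split v hv with ⟨hvS, hvi⟩ | ⟨hvU, hvi⟩ <;>
      simp only [hti, hvi, if_true, if_false] at h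
    · exact rankBelow_injOn S htS hvS (by rw [← hP]; omega)
    · have := havoid v hvU
      have := PkS t htS
      have := P0 t
      omega
    · have := havoid t htU
      have := PkS v hvS
      have := P0 v
      omega
    · exact hginj htU hvU h
  · intro t ht
    rcases split t ht with ⟨htS, hti⟩ | ⟨htU, hti⟩
    · have h1 := PkS t htS
      have h2 := P0 t
      obtain ⟨h3, h4⟩ := hull (u - p + P t) (by omega) (by omega)
      exact ⟨_, h3, by simp only [hti, if_true]; omega⟩
    · obtain ⟨x, hx, hgx⟩ := hgimg t htU
      obtain ⟨y, hy, hxy⟩ := himg' x hx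
      exact ⟨y, hy, by simp only [hti, if_false]; rw [hgx, hxy]⟩
  · intro t ht
    rcases split t ht with ⟨htS, hti⟩ | ⟨htU, hti⟩
    · have h1 := PkS t htS
      have h2 := P0 t
      have h3 := hLG u (hSU u hu)
      rw [((memS u).1 hu).2] at h3
      simp only [hti, if_true]
      omega
    · simp only [hti, if_false]
      exact hgLG t htU
  · intro t ht v hv htv
    rcases split t ht with ⟨htS, hti⟩ | ⟨htU, hti⟩
    · have hvi : f v = i := htv ▸ hti
      have h1 := PkS t htS
      have h2 := P0 v
      simp only [hti, hvi, if_true]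
      omega
    · have hvi : f v ≠ i := htv ▸ hti
      simp only [hti, hvi, if_false]
      exact hgw t htU v ((memU' v).2 ⟨hv, hvi⟩) htv

/-! ### Earliest-deadline-first order -/

/-- The units in the slots `0, …, M - 1` can be permuted, without leaving the windows `[L, G]` of
their groups, such that a unit between two units of a group has at most the rank `ρ` of that group.
Here `ρ` refines the order of the deadlines `G`. -/
lemma exists_edf_perm {M : ℕ} {ι : Type*} {f : Fin M → ι} {ρ L G : ι → ℤ}
    (hρG : ∀ i j, ρ i < ρ j → G i ≤ G j)
    (hf : ∀ t : Fin M, L (f t) ≤ (t : ℕ) ∧ ((t : ℕ) : ℤ) ≤ G (f t)) :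
    ∃ π : Equiv.Perm (Fin M),
      (∀ t : Fin M, L (f (π t)) ≤ (t : ℕ) ∧ ((t : ℕ) : ℤ) ≤ G (f (π t))) ∧
      ∀ t u v, t ≤ u → u ≤ v → f (π t) = f (π v) → ρ (f (π u)) ≤ ρ (f (π t)) := by
  classical
  let A : Finset (Equiv.Perm (Fin M)) := Finset.univ.filter fun π =>
    ∀ t : Fin M, L (f (π t)) ≤ (t : ℕ) ∧ ((t : ℕ) : ℤ) ≤ G (f (π t))
  obtain ⟨π, hπ, hmax⟩ := A.exists_max_image
    (fun π => ∑ t : Fin M, ((t : ℕ) : ℤ) * ρ (f (π t))) ⟨1, by simpa [A] using hf⟩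
  have hπA : ∀ t : Fin M, L (f (π t)) ≤ (t : ℕ) ∧ ((t : ℕ) : ℤ) ≤ G (f (π t)) :=
    (Finset.mem_filter.1 hπ).2
  refine ⟨π, hπA, fun t u v htu huv htv => ?_⟩
  by_contra! hlt
  have hne : u ≠ v := by
    rintro rfl
    rw [htv] at hlt
    exact lt_irrefl _ hlt
  have huv' : u < v := lt_of_le_of_ne huv hne
  have huvZ : ((u : ℕ) : ℤ) < (v : ℕ) := by exact_mod_cast huv'
  have htuZ : ((t : ℕ) : ℤ) ≤ (u : ℕ) := by exact_mod_cast htu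
  rw [htv] at hlt
  -- Exchanging the units at `u` and `v` keeps all windows and increases the maximized sum.
  have hmem : (Equiv.swap u v).trans π ∈ A := by
    refine Finset.mem_filter.2 ⟨Finset.mem_univ _, fun x => ?_⟩
    rw [Equiv.trans_apply]
    have h1 := hπA t
    have h2 := hπA u
    have h3 := hπA v
    have h4 := hρG _ _ hlt
    rw [htv] at h1
    by_cases hxu : x = u
    · subst hxu
      rw [Equiv.swap_apply_left]
      omega
    · by_cases hxv : x = v
      · subst hxv
        rw [Equiv.swap_apply_right]
        omega
      · rw [Equiv.swap_apply_of_ne_of_ne hxu hxv]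
        exact hπA x
  have h := hmax _ hmem
  have hsum : ∑ x : Fin M, (((x : ℕ) : ℤ) * ρ (f (((Equiv.swap u v).trans π) x))
      - ((x : ℕ) : ℤ) * ρ (f (π x)))
      = ((v : ℕ) - (u : ℕ) : ℤ) * (ρ (f (π u)) - ρ (f (π v))) := by
    rw [Finset.sum_eq_add u v hne]
    · simp only [Equiv.trans_apply, Equiv.swap_apply_left, Equiv.swap_apply_right]
      ring
    · intro x _ hx
      rw [Equiv.trans_apply, Equiv.swap_apply_of_ne_of_ne hx.1 hx.2, sub_self]
    · simp
    · simp
  rw [Finset.sum_sub_distrib] at hsum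
  have hpos : (0 : ℤ) < ((v : ℕ) - (u : ℕ) : ℤ) * (ρ (f (π u)) - ρ (f (π v))) :=
    mul_pos (by omega) (by omega)
  omega

/-- If unit `t` of group `f t` lies in its window `[L, G]` and group `i` has at most `w i ≤ 2 R` units,
then the units can be permuted such that two units of group `i` differ by less than `w i` and all
units lie in the windows `[L - R, G + R - 1]`. -/
theorem exists_perm_contiguous {M n : ℕ} {f : Fin M → Fin n} {w : Fin n → ℕ}
    {L G : Fin n → ℤ} {R : ℤ} (hR : 0 < R) (hw : ∀ i, (w i : ℤ) ≤ 2 * R)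
    (hf : ∀ t : Fin M, L (f t) ≤ (t : ℕ) ∧ ((t : ℕ) : ℤ) ≤ G (f t))
    (hcard : ∀ i, (Finset.univ.filter (f · = i)).card ≤ w i) :
    ∃ σ : Equiv.Perm (Fin M),
      (∀ j, L (f j) - R ≤ (σ j : ℕ) ∧ ((σ j : ℕ) : ℤ) < G (f j) + R) ∧
      ∀ j j', f j = f j' → ((σ j : ℕ) : ℤ) - (σ j' : ℕ) < w (f j) := by
  rcases M.eq_zero_or_pos with rfl | hM
  · exact ⟨1, fun j => j.elim0, fun j => j.elim0⟩
  have : NeZero M := ⟨hM.ne'⟩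
  -- Deadlines, with ties broken by the index of the group.
  let ρ : Fin n → ℤ := fun i => G i * n + (i : ℕ)
  have hlt : ∀ i j, G i < G j → ρ i < ρ j := fun i j h => by
    have h1 : (((i : Fin n) : ℕ) : ℤ) < n := by exact_mod_cast i.2
    simp only [ρ]
    nlinarith
  have hρG : ∀ i j, ρ i < ρ j → G i ≤ G j := fun i j h => by
    by_contra! hc
    exact absurd (hlt j i hc) (not_lt.2 h.le)
  have hρ : Function.Injective ρ := fun i j h => by
    have h1 : G i = G j := le_antisymm
      (not_lt.1 fun hc => absurd h (hlt j i hc).ne') (not_lt.1 fun hc => absurd h (hlt i j hc).ne)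
    simp only [ρ, h1] at h
    exact Fin.ext (by omega)
  obtain ⟨π, hπ, hedf⟩ := exists_edf_perm hρG hf
  let e : ℤ → Fin M := fun t => Fin.ofNat M t.toNat
  have he : ∀ j : Fin M, e ((j : ℕ) : ℤ) = j := fun j => by simp [e]
  have hU : ∀ t ∈ Finset.Ico (0 : ℤ) M, ∃ j : Fin M, ((j : ℕ) : ℤ) = t := fun t ht => by
    obtain ⟨h0, h1⟩ := Finset.mem_Ico.1 ht
    exact ⟨⟨t.toNat, by omega⟩, by simp [h0]⟩
  have hmem : ∀ j : Fin M, ((j : ℕ) : ℤ) ∈ Finset.Ico (0 : ℤ) M := fun j =>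
    Finset.mem_Ico.2 ⟨by omega, by have := j.2; omega⟩
  obtain ⟨g, hinj, himg, hLG, hgw⟩ := exists_consolidation hρ hw (L := L) (G := G)
    (f := fun t => f (π (e t))) (Finset.Ico (0 : ℤ) M) id (strictMono_id.strictMonoOn _)
    (fun t _ => by simp only [id]; omega)
    (by
      intro t ht
      obtain ⟨j, rfl⟩ := hU t ht
      simpa only [he] using hπ j)
    (by
      intro i
      refine le_trans (Finset.card_le_card_of_injOn (fun t => π (e t)) ?_ ?_) (hcard i)
      · intro t ht
        simpa using (Finset.mem_filter.1 ht).2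
      · intro t ht v hv h
        obtain ⟨j, rfl⟩ := hU t (Finset.mem_filter.1 ht).1
        obtain ⟨j', rfl⟩ := hU v (Finset.mem_filter.1 hv).1
        simp only [he] at h
        rw [π.injective h])
    (by
      intro t ht v hv htv x h1 h2
      have hx : x ∈ Finset.Ico (0 : ℤ) M := by
        rw [Finset.mem_Ico] at ht hv ⊢
        omega
      refine ⟨hx, ?_, by simp⟩
      obtain ⟨j, rfl⟩ := hU t ht
      obtain ⟨j', rfl⟩ := hU v hv
      obtain ⟨x, rfl⟩ := hU x hx
      simp only [he] at htv ⊢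
      exact hedf j x j' (by exact_mod_cast h1) (by exact_mod_cast h2) htv)
  have hτ : ∀ j : Fin M, ∃ j' : Fin M, ((j' : ℕ) : ℤ) = g ((j : ℕ) : ℤ) := fun j => by
    obtain ⟨s, hs, h⟩ := himg _ (hmem j)
    rw [h]
    exact hU s hs
  choose τ hτ using hτ
  have hτinj : Function.Injective τ := fun j j' h => by
    have h1 := hinj (hmem j) (hmem j') (by rw [← hτ, ← hτ, h])
    exact Fin.ext (by exact_mod_cast h1)
  refine ⟨π.symm.trans (Equiv.ofBijective τ hτinj.bijective_of_finite), fun j => ?_,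
    fun j j' h => ?_⟩
  · have := hLG _ (hmem (π.symm j))
    simpa [he, hτ] using this
  · have := hgw _ (hmem (π.symm j)) _ (hmem (π.symm j')) (by simpa [he] using h)
    simpa [he, hτ] using this

namespace MMSMInstance

/-! ### The bipartite graph and its matchings -/

variable {I : MMSMInstance}

lemma moveDist_le_iff {i : Fin I.n} {c d : ℝ} (hd : 0 ≤ d) :
    I.moveDist i c ≤ d ↔ (I.x i - c) ^ 2 + I.y i ^ 2 ≤ d ^ 2 := by
  rw [moveDist, sub_zero, Real.sqrt_le_left hd]

lemma H_adj {D : ℝ} {j : Fin I.M} {v : Σ i : Fin I.n, Fin (I.w i)} :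
    (I.H D).Adj (Sum.inl j) (Sum.inr v) ↔ ((j : ℕ) : ℤ) ∈ I.J D v.1 := by
  obtain ⟨i, l⟩ := v
  simp only [H, SimpleGraph.fromRel_adj]
  constructor
  · rintro ⟨-, ⟨j', i', l', h1, h2, h3⟩ | ⟨j', i', l', h1, -⟩⟩
    · cases h1
      cases h2
      exact h3
    · cases h1
  · exact fun h => ⟨by simp, Or.inl ⟨j, i, l, rfl, rfl, h⟩⟩

lemma exists_eq_of_H_adj {D : ℝ} {u v : I.Vertex} (h : (I.H D).Adj u v) :
    (∃ j c, u = Sum.inl j ∧ v = Sum.inr c) ∨ ∃ j c, u = Sum.inr c ∧ v = Sum.inl j := by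
  obtain ⟨-, ⟨j, i, l, h1, h2, -⟩ | ⟨j, i, l, h1, h2, -⟩⟩ := (SimpleGraph.fromRel_adj _ _ _).1 h
  · exact Or.inl ⟨j, _, h1, h2⟩
  · exact Or.inr ⟨j, _, h2, h1⟩

/-- A matching has at most as many edges as there are barrier edges that it matches. -/
lemma ncard_edgeSet_le {D : ℝ} {Y : (I.H D).Subgraph} (hY : Y.IsMatching) :
    Y.edgeSet.ncard ≤ {j : Fin I.M | ∃ c, Y.Adj (Sum.inl j) (Sum.inr c)}.ncard := by
  classical
  set A := {j : Fin I.M | ∃ c, Y.Adj (Sum.inl j) (Sum.inr c)} with hA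
  have hp : ∀ j : A, ∃ c, Y.Adj (Sum.inl j.1) (Sum.inr c) := fun j => j.2
  choose c hc using hp
  have hsub : Y.edgeSet ⊆ Set.range fun j : A => s(Sum.inl j.1, Sum.inr (c j)) := by
    have key : ∀ j c', Y.Adj (Sum.inl j) (Sum.inr c') →
        ∃ j' : A, s(Sum.inl j'.1, Sum.inr (c j')) = s(Sum.inl j, Sum.inr c') := by
      intro j c' h
      refine ⟨⟨j, c', h⟩, ?_⟩
      rw [hY.eq_of_adj_left h (hc ⟨j, c', h⟩)]
    intro e he
    induction e using Sym2.ind with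
    | _ u v =>
      rw [SimpleGraph.Subgraph.mem_edgeSet] at he
      rcases exists_eq_of_H_adj he.adj_sub with ⟨j, c', rfl, rfl⟩ | ⟨j, c', rfl, rfl⟩
      · exact key j c' he
      · obtain ⟨j', hj'⟩ := key j c' he.symm
        exact ⟨j', hj'.trans Sym2.eq_swap⟩
  calc Y.edgeSet.ncard ≤ _ := Set.ncard_le_ncard hsub (Set.finite_range _)
    _ ≤ A.ncard := by
      rw [← Set.image_univ]
      exact (Set.ncard_image_le Set.finite_univ).trans (by rw [Set.ncard_univ]; rfl)

lemma ncard_edgeSet_le_M {D : ℝ} {Y : (I.H D).Subgraph} (hY : Y.IsMatching) :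
    Y.edgeSet.ncard ≤ I.M :=
  (ncard_edgeSet_le hY).trans <|
    (Set.ncard_le_ncard (Set.subset_univ _) Set.finite_univ).trans (by simp [Set.ncard_univ])

lemma exists_adj_of_returnsFeasible {D : ℝ} {Y : (I.H D).Subgraph} (hY : Y.IsMatching)
    (h : I.ReturnsFeasible D Y) (j : Fin I.M) : ∃ c, Y.Adj (Sum.inl j) (Sum.inr c) := by
  have h1 := ncard_edgeSet_le hY
  rw [h] at h1
  have h2 : {j : Fin I.M | ∃ c, Y.Adj (Sum.inl j) (Sum.inr c)} = Set.univ :=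
    Set.eq_of_subset_of_ncard_le (Set.subset_univ _) (by simpa [Set.ncard_univ] using h1)
      Set.finite_univ
  exact (Set.eq_univ_iff_forall.1 h2) j

lemma exists_matching_of_injective {D : ℝ} {c : Fin I.M → Σ i : Fin I.n, Fin (I.w i)}
    (hc : Function.Injective c) (hJ : ∀ j, ((j : ℕ) : ℤ) ∈ I.J D (c j).1) :
    ∃ Y : (I.H D).Subgraph, Y.IsMatching ∧ I.M ≤ Y.edgeSet.ncard := by
  have hadj : ∀ j, (I.H D).Adj (Sum.inl j) (Sum.inr (c j)) := fun j => H_adj.2 (hJ j)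
  refine ⟨⨆ j, (I.H D).subgraphOfAdj (hadj j), SimpleGraph.Subgraph.IsMatching.iSup
    (fun j => SimpleGraph.Subgraph.IsMatching.subgraphOfAdj (hadj j)) ?_, ?_⟩
  · intro j j' hne
    simp [SimpleGraph.support_subgraphOfAdj, hne.symm, (hc.ne hne).symm]
  · have hinj : Function.Injective
        fun j => (s(Sum.inl j, Sum.inr (c j)) : Sym2 I.Vertex) := fun j j' h =>
      (show j = j' ∧ c j = c j' by simpa using h).1
    calc I.M = (Set.range fun j => (s(Sum.inl j, Sum.inr (c j)) : Sym2 I.Vertex)).ncard := by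
          rw [← Set.image_univ, Set.ncard_image_of_injective _ hinj, Set.ncard_univ]
          simp
      _ ≤ _ := Set.ncard_le_ncard (by
          rintro _ ⟨j, rfl⟩
          rw [SimpleGraph.Subgraph.mem_edgeSet, SimpleGraph.Subgraph.iSup_adj]
          exact ⟨j, by simp⟩) (Set.toFinite _)

/-! ### From a solution to a matching -/

/-- The closed intervals covered by the sensors of a solution cover the integers `j < M` even when
their right ends are removed: points slightly to the right of `j` are covered too. -/
lemma IsSolution.exists_half_open_cover {d : ℝ} {x' : Fin I.n → ℝ} (h : I.IsSolution d x')
    (j : Fin I.M) :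
    ∃ i, x' i - I.r i ≤ (j : ℕ) ∧ ((j : ℕ) : ℝ) < x' i - I.r i + I.w i := by
  by_contra! hc
  have hj : ((j : ℕ) : ℝ) + 1 ≤ I.M := by exact_mod_cast j.2
  have h1 : ∀ᶠ p : ℝ in nhdsWithin ((j : ℕ) : ℝ) (Set.Ioi ((j : ℕ) : ℝ)), p < (j : ℕ) + 1 :=
    nhdsWithin_le_nhds (eventually_lt_nhds (by linarith))
  have h2 : ∀ᶠ p : ℝ in nhdsWithin ((j : ℕ) : ℝ) (Set.Ioi ((j : ℕ) : ℝ)),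
      ∀ i, ¬ |p - x' i| ≤ I.r i := by
    rw [Filter.eventually_all]
    intro i
    by_cases hi : x' i - I.r i ≤ (j : ℕ)
    · filter_upwards [self_mem_nhdsWithin] with p hp
      have h3 := hc i hi
      have h4 : ((j : ℕ) : ℝ) < p := hp
      rw [abs_le]
      rintro ⟨-, h5⟩
      have h6 : I.r i = I.w i / 2 := rfl
      linarith
    · filter_upwards [nhdsWithin_le_nhds (eventually_lt_nhds (not_le.1 hi))] with p hp
      rw [abs_le]
      rintro ⟨h5, -⟩
      linarith
  obtain ⟨p, ⟨hp1, hp2⟩, hp3⟩ := ((h1.and h2).and self_mem_nhdsWithin).exists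
  have hp3 : ((j : ℕ) : ℝ) < p := hp3
  obtain ⟨i, hi⟩ := h.2 p ⟨(Nat.cast_nonneg _).trans hp3.le, hp1.le.trans hj⟩
  exact hp2 i hi

/-- A feasible instance has a matching of all `M` barrier edges: with `a i = x' i - r i`, the edge `e_j`
is matched to the copy number `j - ⌈a i⌉` of a sensor `i` with `a i ≤ j < a i + w i`. -/
lemma Feasible.exists_matching {d : ℝ} (hd : 0 ≤ d) (h : I.Feasible d) :
    ∃ Y : (I.H d).Subgraph, Y.IsMatching ∧ I.M ≤ Y.edgeSet.ncard := by
  obtain ⟨x', h⟩ := h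
  choose i hi1 hi2 using h.exists_half_open_cover
  set a : Fin I.n → ℤ := fun i => ⌈x' i - I.r i⌉ with ha
  have ha1 : ∀ j, a (i j) ≤ (j : ℕ) := fun j => Int.ceil_le.2 (by exact_mod_cast hi1 j)
  have ha2 : ∀ j : Fin I.M, ((j : ℕ) : ℤ) < a (i j) + I.w (i j) := fun j => by
    have h1 := hi2 j
    have h2 := Int.le_ceil (x' (i j) - I.r (i j))
    have h3 : (((j : ℕ) : ℤ) : ℝ) < ((a (i j) + I.w (i j) : ℤ) : ℝ) := by
      push_cast
      simp only [ha]
      linarith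
    exact_mod_cast h3
  refine exists_matching_of_injective
    (c := fun j => ⟨i j, ⟨(((j : ℕ) : ℤ) - a (i j)).toNat, ?_⟩⟩) ?_ ?_
  · have := ha1 j
    have := ha2 j
    omega
  · intro j j' hjj
    have h1 : i j = i j' := congrArg Sigma.fst hjj
    have h2 : (((j : ℕ) : ℤ) - a (i j)).toNat = (((j' : ℕ) : ℤ) - a (i j')).toNat :=
      congrArg (fun s : Σ i : Fin I.n, Fin (I.w i) => (s.2 : ℕ)) hjj
    have h3 := ha1 j
    have h4 := ha1 j'
    rw [h1] at h2 h3
    exact Fin.ext (by omega)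
  · intro j
    have h1 := (moveDist_le_iff hd).1 (h.1 (i j))
    have h2 : |I.x (i j) - x' (i j)| ≤ Real.sqrt (d ^ 2 - I.y (i j) ^ 2) :=
      Real.abs_le_sqrt (by linarith)
    have h3 := abs_le.1 h2
    have h4 : I.r (i j) = I.w (i j) / 2 := rfl
    have h5 := hi1 j
    have h6 := hi2 j
    refine ⟨abs_le_of_sq_le_sq (by nlinarith [sq_nonneg (I.x (i j) - x' (i j))]) hd, ?_, ?_⟩
    · refine Int.ceil_le.2 ?_
      simp only [leftmost]
      push_cast
      linarith
    · refine Int.le_floor.2 ?_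
      simp only [rightmost]
      push_cast
      linarith

lemma IsSolution.mono {d d' : ℝ} {x' : Fin I.n → ℝ} (h : I.IsSolution d x') (hd : d ≤ d') :
    I.IsSolution d' x' :=
  ⟨fun i => (h.1 i).trans hd, h.2⟩

lemma lt_Dstar_of_not_feasible {D : ℕ} (h : ¬ I.Feasible D) : (D : ℕ∞) < I.Dstar := by
  refine lt_of_lt_of_le (b := ((D + 1 : ℕ) : ℕ∞)) (by exact_mod_cast D.lt_succ_self) ?_
  refine le_iInf₂ fun D' hD' => ?_
  have h1 : D < D' := by
    by_contra! hc
    obtain ⟨x', hx'⟩ := hD'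
    exact h ⟨x', hx'.mono (by exact_mod_cast hc)⟩
  exact_mod_cast h1

/-! ### From a matching to a solution -/

/-- The reach of a sensor along the axis grows by at least `ρ` when the relocation distance bound
grows by `ρ`. -/
lemma moveDist_le_of_abs_le {i : Fin I.n} {c d ρ : ℝ} (hρ : 0 ≤ ρ) (hy : |I.y i| ≤ d)
    (h : |I.x i - c| ≤ Real.sqrt (d ^ 2 - I.y i ^ 2) + ρ) : I.moveDist i c ≤ d + ρ := by
  have hd : 0 ≤ d := (abs_nonneg _).trans hy
  have h0 : 0 ≤ d ^ 2 - I.y i ^ 2 := sub_nonneg.2 (sq_le_sq.2 (by rwa [abs_of_nonneg hd]))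
  have h1 := Real.sq_sqrt h0
  have h2 := Real.sqrt_nonneg (d ^ 2 - I.y i ^ 2)
  have h3 : Real.sqrt (d ^ 2 - I.y i ^ 2) ≤ d :=
    (Real.sqrt_le_left hd).2 (by linarith [sq_nonneg (I.y i)])
  rw [moveDist_le_iff (by linarith)]
  have h4 : (I.x i - c) ^ 2 ≤ (Real.sqrt (d ^ 2 - I.y i ^ 2) + ρ) ^ 2 :=
    sq_le_sq.2 (by rwa [abs_of_nonneg (by linarith : 0 ≤ Real.sqrt (d ^ 2 - I.y i ^ 2) + ρ)])
  nlinarith [mul_le_mul_of_nonneg_right h3 hρ]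

lemma w_le_two_mul_rmax (i : Fin I.n) : (I.w i : ℝ) ≤ 2 * I.rmax := by
  have h : I.w i ≤ Finset.univ.sup I.w := Finset.le_sup (Finset.mem_univ i)
  have h' : (I.w i : ℝ) ≤ ((Finset.univ.sup I.w : ℕ) : ℝ) := by exact_mod_cast h
  rw [rmax]
  linarith

/-- A sensor can cover all unit edges with indices in `S` from a single position if these indices
differ by less than `w i` and the edges lie between the extreme points it covers within distance
`d`, up to an error of `ρ` that is paid for by the longer relocation distance. -/
lemma exists_position {d ρ : ℝ} {i : Fin I.n} (hρ : 0 ≤ ρ) (hy : |I.y i| ≤ d)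
    {S : Finset ℤ} (hS : S.Nonempty) (hdiam : ∀ s ∈ S, ∀ t ∈ S, s - t < I.w i)
    (hwin : ∀ s ∈ S, I.leftmost d i - ρ ≤ s ∧ (s : ℝ) + 1 ≤ I.rightmost d i + ρ) :
    ∃ c : ℝ, I.moveDist i c ≤ d + ρ ∧
      ∀ s ∈ S, ∀ p ∈ Set.Icc (s : ℝ) (s + 1), |p - c| ≤ I.r i := by
  have hr : I.r i = I.w i / 2 := rfl
  obtain ⟨m, hm, hmin⟩ := S.exists_min_image id hS
  obtain ⟨m₁, hM, hmax⟩ := S.exists_max_image id hS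
  have h1 : (m₁ : ℝ) + 1 ≤ m + I.w i := by
    have h := hdiam m₁ hM m hm
    have h' : m₁ + 1 ≤ m + I.w i := by omega
    exact_mod_cast h'
  obtain ⟨h2, -⟩ := hwin m hm
  obtain ⟨-, h3⟩ := hwin m₁ hM
  have h4 := Real.sqrt_nonneg (d ^ 2 - I.y i ^ 2)
  rw [leftmost] at h2
  rw [rightmost] at h3
  -- The leftmost position that covers the last edge and is within reach.
  refine ⟨max (m₁ + 1 - I.r i) (I.x i - Real.sqrt (d ^ 2 - I.y i ^ 2) - ρ),
    moveDist_le_of_abs_le hρ hy (abs_le.2 ⟨?_, ?_⟩), fun s hs p hp => abs_le.2 ⟨?_, ?_⟩⟩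
  · rw [neg_le_sub_iff_le_add, max_le_iff]
    constructor <;> linarith
  · linarith [le_max_right ((m₁ : ℝ) + 1 - I.r i) (I.x i - Real.sqrt (d ^ 2 - I.y i ^ 2) - ρ)]
  · have h5 : (m : ℝ) ≤ s := by exact_mod_cast hmin s hs
    have h6 : max ((m₁ : ℝ) + 1 - I.r i) (I.x i - Real.sqrt (d ^ 2 - I.y i ^ 2) - ρ)
        ≤ m + I.r i := max_le (by linarith) (by linarith)
    linarith [hp.1]
  · have h5 : (s : ℝ) ≤ m₁ := by exact_mod_cast hmax s hs
    linarith [hp.2, le_max_left ((m₁ : ℝ) + 1 - I.r i)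
      (I.x i - Real.sqrt (d ^ 2 - I.y i ^ 2) - ρ)]

/-- A matching of all barrier edges can be transferred to a relocation within distance `D + r_max`.
Sensors without matched copies keep their abscissa. -/
lemma exists_relocation {D : ℝ} {Y : (I.H D).Subgraph} (hY : Y.IsMatching) (hM : 0 < I.M)
    (hfeas : I.ReturnsFeasible D Y) {R : ℕ} (hR : I.rmax = R) :
    ∃ (x' : Fin I.n → ℝ) (σ : Equiv.Perm (Fin I.M)),
      (∀ i, (∃ j, I.Assigns D Y j i) ∨ x' i = I.x i) ∧
      ∀ j i, I.Assigns D Y j i →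
        I.moveDist i (x' i) ≤ D + I.rmax ∧ I.CoversEdge i (x' i) (σ j) := by
  classical
  choose c hc using exists_adj_of_returnsFeasible hY hfeas
  have hcinj : Function.Injective c := fun j j' h =>
    Sum.inl_injective (hY.eq_of_adj_right (hc j) (h ▸ hc j'))
  have hassign : ∀ j i, I.Assigns D Y j i ↔ (c j).1 = i := fun j i => by
    constructor
    · rintro ⟨l, hl⟩
      rw [Sum.inr_injective (hY.eq_of_adj_left (hc j) hl)]
    · rintro rfl
      exact ⟨(c j).2, hc j⟩
  have hJ : ∀ j, ((j : ℕ) : ℤ) ∈ I.J D (c j).1 := fun j => H_adj.1 (hc j).adj_sub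
  have hw : ∀ i, (I.w i : ℤ) ≤ 2 * (R : ℤ) := fun i => by
    have h := w_le_two_mul_rmax i
    rw [hR] at h
    exact_mod_cast h
  -- The sensor matched to `e_0` has a copy, hence a positive diameter.
  have hR0 : (0 : ℤ) < R := by
    have h1 := (c ⟨0, hM⟩).2.2
    have h2 := hw (c ⟨0, hM⟩).1
    omega
  obtain ⟨σ, hσ, hσw⟩ := exists_perm_contiguous (f := fun j => (c j).1) (w := I.w)
    (L := fun i => ⌈I.leftmost D i⌉) (G := fun i => ⌊I.rightmost D i⌋) hR0 hw
    (fun j => (hJ j).2) (fun i => by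
      have h : (Finset.univ.filter fun j => (c j).1 = i).card
          ≤ ((Finset.univ : Finset (Fin (I.w i))).map
            (⟨Sigma.mk i, sigma_mk_injective⟩ : _ ↪ Σ i : Fin I.n, Fin (I.w i))).card := by
        refine Finset.card_le_card_of_injOn c (fun j hj => ?_) hcinj.injOn
        obtain rfl := (Finset.mem_filter.1 hj).2
        simp
      simpa using h)
  have hpos : ∀ i, ∃ x : ℝ, ((∃ j, I.Assigns D Y j i) ∨ x = I.x i) ∧ ∀ j, I.Assigns D Y j i →
      I.moveDist i x ≤ D + I.rmax ∧ I.CoversEdge i x (σ j) := by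
    intro i
    by_cases hi : ∃ j, I.Assigns D Y j i
    · obtain ⟨j₀, hj₀⟩ := hi
      have hmem : ∀ j, I.Assigns D Y j i → ((σ j : ℕ) : ℤ) ∈
          (Finset.univ.filter fun j => (c j).1 = i).image fun j => ((σ j : ℕ) : ℤ) :=
        fun j hj => Finset.mem_image_of_mem _
          (Finset.mem_filter.2 ⟨Finset.mem_univ _, (hassign j i).1 hj⟩)
      obtain ⟨x, hx1, hx2⟩ := exists_position (d := D) (ρ := R) (i := i) (Nat.cast_nonneg R)
        ((hassign j₀ i).1 hj₀ ▸ (hJ j₀).1) ⟨_, hmem j₀ hj₀⟩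
        (by
          intro s hs t ht
          obtain ⟨j, hj, rfl⟩ := Finset.mem_image.1 hs
          obtain ⟨j', hj', rfl⟩ := Finset.mem_image.1 ht
          have h1 := (Finset.mem_filter.1 hj).2
          have h2 := (Finset.mem_filter.1 hj').2
          simpa only [h1] using hσw j j' (h1.trans h2.symm))
        (by
          intro s hs
          obtain ⟨j, hj, rfl⟩ := Finset.mem_image.1 hs
          have h1 := (Finset.mem_filter.1 hj).2
          obtain ⟨h2, h3⟩ := hσ j
          simp only [h1] at h2 h3
          have h4 := Int.le_ceil (I.leftmost D i)
          have h5 := Int.floor_le (I.rightmost D i)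
          have h6 : ((⌈I.leftmost D i⌉ - R : ℤ) : ℝ) ≤ (((σ j : ℕ) : ℤ) : ℝ) := by
            exact_mod_cast h2
          have h7 : ((((σ j : ℕ) : ℤ) + 1 : ℤ) : ℝ) ≤ ((⌊I.rightmost D i⌋ + R : ℤ) : ℝ) := by
            exact_mod_cast h3
          push_cast at h6 h7 ⊢
          constructor <;> linarith)
      refine ⟨x, Or.inl ⟨j₀, hj₀⟩, fun j hj => ⟨hR ▸ hx1, fun p hp => ?_⟩⟩
      exact hx2 _ (hmem j hj) p (by simpa using hp)
    · exact ⟨I.x i, Or.inr rfl, fun j hj => absurd ⟨j, hj⟩ hi⟩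
  choose x' hx' using hpos
  exact ⟨x', σ, fun i => (hx' i).1, fun j i hj => (hx' i).2 j hj⟩

lemma isSolution_of_coversEdge (hM : 0 < I.M) {d : ℝ} {x' : Fin I.n → ℝ}
    (hd : ∀ i, I.moveDist i (x' i) ≤ d) (h : ∀ j, ∃ i, I.CoversEdge i (x' i) j) :
    I.IsSolution d x' := by
  refine ⟨hd, fun p hp => ?_⟩
  -- The right endpoint `p = M` belongs to the last edge.
  obtain ⟨j, hj⟩ : ∃ j : Fin I.M, p ∈ Set.Icc ((j : ℕ) : ℝ) ((j : ℕ) + 1) := by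
    rcases hp.2.lt_or_eq with hlt | heq
    · exact ⟨⟨⌊p⌋₊, (Nat.floor_lt hp.1).2 hlt⟩, Nat.floor_le hp.1, (Nat.lt_floor_add_one p).le⟩
    · refine ⟨⟨I.M - 1, by omega⟩, ?_⟩
      have h1 : ((I.M - 1 : ℕ) : ℝ) + 1 = I.M := by
        exact_mod_cast Nat.sub_add_cancel hM
      simp only [heq]
      constructor <;> linarith
  obtain ⟨i, hi⟩ := h j
  exact ⟨i, hi p hj⟩

end MMSMInstance

theorem mainTheorem3 (I : MMSMInstance) (hM : 0 < I.M) (D : ℕ)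
    (Y : (I.H (D : ℝ)).Subgraph) (hY : I.IsMaximumMatching (D : ℝ) Y) :
    (¬ I.ReturnsFeasible (D : ℝ) Y → (D : ℕ∞) < I.Dstar) ∧
    (I.ReturnsFeasible (D : ℝ) Y → (∃ R : ℕ, I.rmax = R) →
      ∃ (x' : Fin I.n → ℝ) (σ : Equiv.Perm (Fin I.M)),
        (∀ j i, I.Assigns (D : ℝ) Y j i →
          I.moveDist i (x' i) ≤ D + I.rmax ∧ I.CoversEdge i (x' i) (σ j)) ∧
        ((∀ i, |I.y i| ≤ D + I.rmax) → I.IsSolution (D + I.rmax) x')) := by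
  constructor
  · intro hinf
    refine MMSMInstance.lt_Dstar_of_not_feasible fun hfeas => hinf ?_
    obtain ⟨Y', hY', hcard⟩ := hfeas.exists_matching (Nat.cast_nonneg D)
    exact le_antisymm (MMSMInstance.ncard_edgeSet_le_M hY.1) (hcard.trans (hY.2 Y' hY'))
  · rintro hfeas ⟨R, hR⟩
    obtain ⟨x', σ, hstay, hcover⟩ := MMSMInstance.exists_relocation hY.1 hM hfeas hR
    refine ⟨x', σ, hcover, fun hy => MMSMInstance.isSolution_of_coversEdge hM (fun i => ?_)
      fun j => ?_⟩
    · rcases hstay i with ⟨j, hj⟩ | hi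
      · exact (hcover j i hj).1
      · rw [MMSMInstance.moveDist, hi, sub_self, sub_zero, zero_pow two_ne_zero, zero_add,
          Real.sqrt_sq_eq_abs]
        exact hy i
    · obtain ⟨⟨i, l⟩, hc⟩ :=
        MMSMInstance.exists_adj_of_returnsFeasible hY.1 hfeas (σ.symm j)
      exact ⟨i, by simpa using (hcover (σ.symm j) i ⟨l, hc⟩).2⟩
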